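/- Let $n\ge 1$, $T>0$, $I=[0,T]$, $J=[0,2T]$, let $a_0,\dots,a_{2n-1}\in L^1(I)$, and put $$Lu=u^{(2n)}+a_{2n-1}u^{(2n-1)}+\dots+a_1u'+a_0u\quad\text{on } I .$$ Let $\widetilde L$ be the operator of the same form on $J$ whose coefficients of even index $2k$ are the even extensions, and whose coefficients of odd index $2k+1$ are the odd extensions, of those of $L$ with respect to the point $T$ (that is, $\tilde a_{2k}(t)=a_{2k}(2T-t)$ and $\hat a_{2k+1}(t)=-a_{2k+1}(2T-t)$ for $t\in(T,2T]$). For a compact interval $K$ let $W^{2n,1}(K)$ be the set of $u\in C^{2n-1}(K)$ with $u^{(2n-1)}$ absolutely continuous. Let $$X_{N,2T}=\{u\in W^{2n,1}(J):\ u^{(2k+1)}(0)=u^{(2k+1)}(2T)=0,\ k=0,\dots,n-1\},$$ and suppose that $\widetilde L$ is nonresonant in $X_{N,2T}$, i.e. that $\widetilde Lu=0$ a.e. on $J$, $u\in X_{N,2T}$, has only the trivial solution. Let $G_N[2T]$ be the Green's function of $\widetilde L$ on $X_{N,2T}$, i.e. the continuous kernel on $J\times J$ such that for every $\sigma\in L^1(J)$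 the function $u(t)=\int_0^{2T}G_N[2T](t,s)\,\sigma(s)\,ds$ is the (unique) solution of $\widetilde Lu=\sigma$ a.e. on $J$, $u\in X_{N,2T}$. Let $\sigma_1,\sigma_2\in L^1(I)$. Let $u_N\in W^{2n,1}(I)$ be the solution of the Neumann problem $$Lu=\sigma_1\ \text{a.e. on } I,\qquad u^{(2k+1)}(0)=u^{(2k+1)}(T)=0,\quad k=0,\dots,n-1,$$ and let $u_{M_1}\in W^{2n,1}(I)$ be the solution of Mixed problem 1 $$Lu=\sigma_2\ \text{a.e. on } I,\qquad u^{(2k+1)}(0)=u^{(2k)}(T)=0,\quad k=0,\dots,n-1.$$ Then: 1. If $G_N[2T]\ge 0$ on $J\times J$ and $|\sigma_2(t)|\le\sigma_1(t)$ for a.e. $t\in I$, then $|u_{M_1}(t)|\le u_N(t)$ for all $t\in I$. 2. If $G_N[2T]\le 0$ on $J\times J$ and $0\le\sigma_2(t)\le\sigma_1(t)$ for a.e. $t\in I$, then $u_N(t)\le 0$ and $u_N(t)\le u_{M_1}(t)$ for all $t\in I$. 3. If $G_N[2T]\le 0$ on $J\times J$ and $\sigma_1(t)\le\sigma_2(t)\le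 0$ for a.e. $t\in I$, then $u_N(t)\ge 0$ and $u_{M_1}(t)\le u_N(t)$ for all $t\in I$. -/

import Mathlib

open MeasureTheory Set

noncomputable section

namespace EvenOrderBVP

/-- `W^{m,1}([0,T])`: the functions of class `C^{m-1}` on `[0,T]` (one-sided derivatives at the end
points) whose derivative of order `m - 1` is absolutely continuous on `[0,T]`. It is used for
`m = 2 n` with `1 ≤ n`. Only the values of a function on `[0,T]` matter. -/
def sobolevSpace (m : ℕ) (T : ℝ) : Set (ℝ → ℝ) :=
  {u | ContDiffOn ℝ ((m - 1 : ℕ) : WithTop ℕ∞) u (Icc 0 T) ∧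
    AbsolutelyContinuousOnInterval (iteratedDerivWithin (m - 1) u (Icc 0 T)) 0 T}

/-- The operator `L u = u^(2n) + a_{2n-1} u^(2n-1) + ⋯ + a_1 u' + a_0 u` on `[0,T]`. For `u` in
`sobolevSpace (2 * n) T` the derivative of order `2 n` exists almost everywhere. -/
def linOp (n : ℕ) (a : ℕ → ℝ → ℝ) (T : ℝ) (u : ℝ → ℝ) (t : ℝ) : ℝ :=
  iteratedDerivWithin (2 * n) u (Icc 0 T) t +
    ∑ k ∈ Finset.range (2 * n), a k t * iteratedDerivWithin k u (Icc 0 T) t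

/-- The coefficients, on `[0,2T]`, of the extended operator: even extension with respect to `T` of
the coefficients of even index, odd extension of the coefficients of odd index. -/
def extCoeff (T : ℝ) (a : ℕ → ℝ → ℝ) (k : ℕ) (t : ℝ) : ℝ :=
  if t ≤ T then a k t else (-1) ^ k * a k (2 * T - t)

/-- Neumann conditions on `[0,T]`: `u^(2k+1)(0) = u^(2k+1)(T) = 0` for `k = 0, …, n-1`. -/
def neumannSpace (n : ℕ) (T : ℝ) : Set (ℝ → ℝ) :=
  {u | u ∈ sobolevSpace (2 * n) T ∧ ∀ k < n,
    iteratedDerivWithin (2 * k + 1) u (Icc 0 T) 0 = 0 ∧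
    iteratedDerivWithin (2 * k + 1) u (Icc 0 T) T = 0}

/-- Mixed conditions 1 on `[0,T]`: `u^(2k+1)(0) = u^(2k)(T) = 0` for `k = 0, …, n-1`. -/
def mixedOneSpace (n : ℕ) (T : ℝ) : Set (ℝ → ℝ) :=
  {u | u ∈ sobolevSpace (2 * n) T ∧ ∀ k < n,
    iteratedDerivWithin (2 * k + 1) u (Icc 0 T) 0 = 0 ∧
    iteratedDerivWithin (2 * k) u (Icc 0 T) T = 0}

/-- `u` solves `L u = σ` almost everywhere on `[0,T]`, `u ∈ X`. -/
def IsSolution (n : ℕ) (a : ℕ → ℝ → ℝ) (T : ℝ) (X : Set (ℝ → ℝ)) (σ u : ℝ → ℝ) : Prop :=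
  u ∈ X ∧ ∀ᵐ t ∂(volume.restrict (Icc 0 T)), linOp n a T u t = σ t

/-- `L` is nonresonant in `X`: the homogeneous problem has only the trivial solution. -/
def Nonresonant (n : ℕ) (a : ℕ → ℝ → ℝ) (T : ℝ) (X : Set (ℝ → ℝ)) : Prop :=
  ∀ u, IsSolution n a T X 0 u → ∀ t ∈ Icc 0 T, u t = 0

/-- `G` is the Green's function of `L` on `X`: the kernel on `[0,T] × [0,T]`, continuous since the
order `2 n` is at least two, such that `u(t) = ∫₀ᵀ G(t,s) σ(s) ds` solves `L u = σ`, `u ∈ X`, for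
every integrable `σ`. When `L` is nonresonant in `X` this is the only solution, and `G` is uniquely
determined on `[0,T] × [0,T]`. -/
def IsGreenFunction (n : ℕ) (a : ℕ → ℝ → ℝ) (T : ℝ) (X : Set (ℝ → ℝ)) (G : ℝ → ℝ → ℝ) : Prop :=
  ContinuousOn (fun p : ℝ × ℝ => G p.1 p.2) (Icc 0 T ×ˢ Icc 0 T) ∧
    ∀ σ : ℝ → ℝ, IntegrableOn σ (Icc 0 T) →
      IsSolution n a T X σ (fun t => ∫ s in (0 : ℝ)..T, G t s * σ s)

end EvenOrderBVP

end

namespace EvenOrderBVP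

open Filter Topology
open scoped Pointwise

/-! The parities of the extended coefficients make the extended operator commute with reflection
about `T`. The even extension of `uN` and the odd extension of `uM` therefore both solve Neumann
problems on `[0,2T]` for this one operator, with the even extension of `σ₁` and the odd extension of
`σ₂` on the right (`isSolution_reflExt`). The boundary conditions at `T` annihilate exactly the
derivatives that would jump there. By nonresonance the same kernel `G` represents both extensions
(`IsSolution.eq_integral`). Since `G` has constant sign, comparing `uN` and `uM` reduces to
comparing the extended data, that is, `σ₁` with both `σ₂` and `-σ₂`. -/

/-- The extension of `f` from `[0,T]` to `[0,2T]` by `ε` times its reflection with respect to `T`: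
the even extension for `ε = 1`, the odd extension for `ε = -1`. -/
noncomputable def reflExt (ε T : ℝ) (f : ℝ → ℝ) (t : ℝ) : ℝ :=
  if t ≤ T then f t else ε * f (2 * T - t)

/-! ### Values and first derivatives of reflections -/

lemma reflExt_of_le {ε T t : ℝ} (f : ℝ → ℝ) (h : t ≤ T) : reflExt ε T f t = f t := if_pos h

lemma reflExt_of_lt {ε T t : ℝ} (f : ℝ → ℝ) (h : T < t) :
    reflExt ε T f t = ε * f (2 * T - t) := if_neg h.not_ge

lemma reflExt_of_ge {ε T t : ℝ} {f : ℝ → ℝ} (hf : f T = ε * f T) (h : T ≤ t) :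
    reflExt ε T f t = ε * f (2 * T - t) := by
  rcases h.eq_or_lt with rfl | h
  · rw [reflExt_of_le f le_rfl, hf]
    ring_nf
  · exact reflExt_of_lt f h

lemma extCoeff_eq_reflExt (T : ℝ) (a : ℕ → ℝ → ℝ) (k : ℕ) :
    extCoeff T a k = reflExt ((-1) ^ k) T (a k) := rfl

/-- Differentiation flips the parity `ε`. At `T`, `h0` matches the values of the two halves and `h1`
their one-sided slopes; for `ε = 1` only `f' T = 0` is required, for `ε = -1` only `f T = 0`. -/
lemma hasDerivWithinAt_reflExt {ε T : ℝ} {f f' : ℝ → ℝ} (hT : 0 < T)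
    (hf : ∀ x ∈ Icc 0 T, HasDerivWithinAt f (f' x) (Icc 0 T) x)
    (h0 : f T = ε * f T) (h1 : f' T = -ε * f' T) {x : ℝ} (hx : x ∈ Icc 0 (2 * T)) :
    HasDerivWithinAt (reflExt ε T f) (reflExt (-ε) T f' x) (Icc 0 (2 * T)) x := by
  have hU : Icc 0 (2 * T) = Icc 0 T ∪ Icc T (2 * T) :=
    (Icc_union_Icc_eq_Icc hT.le (by linarith)).symm
  rw [hU]
  refine HasDerivWithinAt.union ?_ ?_
  · rcases le_or_gt x T with h | h
    · rw [reflExt_of_le f' h]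
      exact (hf x ⟨hx.1, h⟩).congr (fun y hy => reflExt_of_le f hy.2) (reflExt_of_le f h)
    -- Beyond `T` the left piece imposes nothing, as `x` is not in its closure.
    · refine HasFDerivWithinAt.of_notMem_closure ?_
      rw [isClosed_Icc.closure_eq]
      exact fun hh => hh.2.not_gt h
  · rcases le_or_gt T x with h | h
    · rw [reflExt_of_ge h1 h]
      have hd : HasDerivWithinAt (fun y : ℝ => 2 * T - y) (-1) (Icc T (2 * T)) x :=
        (hasDerivWithinAt_id x _).const_sub (2 * T)
      have hm : MapsTo (fun y : ℝ => 2 * T - y) (Icc T (2 * T)) (Icc 0 T) :=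
        fun y hy => ⟨by linarith [hy.2], by linarith [hy.1]⟩
      have := ((hf (2 * T - x) (hm ⟨h, hx.2⟩)).scomp x hd hm).const_mul ε
      refine (this.congr (fun y hy => reflExt_of_ge h0 hy.1)
        (reflExt_of_ge h0 h)).congr_deriv ?_
      simp
    · refine HasFDerivWithinAt.of_notMem_closure ?_
      rw [isClosed_Icc.closure_eq]
      exact fun hh => hh.1.not_gt h

/-- Away from the point of reflection, no regularity is needed. -/
lemma derivWithin_reflExt_of_ne {ε T : ℝ} (f : ℝ → ℝ) {x : ℝ} (hx : x ≠ T) :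
    derivWithin (reflExt ε T f) (Icc 0 (2 * T)) x =
      reflExt (-ε) T (derivWithin f (Icc 0 T)) x := by
  have key : ∀ y < T, derivWithin f (Icc 0 (2 * T)) y = derivWithin f (Icc 0 T) y := by
    intro y hy
    refine derivWithin_congr_set ?_
    filter_upwards [Iio_mem_nhds hy] with z hz
    refine propext ⟨fun h => ⟨h.1, (mem_Iio.1 hz).le⟩, fun h => ⟨h.1, ?_⟩⟩
    linarith [h.1, h.2]
  rcases hx.lt_or_gt with h | h
  · rw [reflExt_of_le _ h.le, ← key x h]
    refine EventuallyEq.derivWithin_eq (nhdsWithin_le_nhds ?_) (reflExt_of_le f h.le)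
    filter_upwards [Iio_mem_nhds h] with z hz using reflExt_of_le f (mem_Iio.1 hz).le
  · rw [reflExt_of_lt _ h, ← key _ (by linarith : 2 * T - x < T)]
    have : derivWithin (reflExt ε T f) (Icc 0 (2 * T)) x =
        derivWithin (fun y => ε * f (2 * T - y)) (Icc 0 (2 * T)) x := by
      refine EventuallyEq.derivWithin_eq (nhdsWithin_le_nhds ?_) (reflExt_of_lt f h)
      filter_upwards [Ioi_mem_nhds h] with z hz using reflExt_of_lt f (mem_Ioi.1 hz)
    rw [this, derivWithin_const_mul_field, derivWithin_comp_const_sub]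
    -- The reflection maps the differentiation domain onto itself.
    have hs : (2 * T) +ᵥ -Icc 0 (2 * T) = Icc 0 (2 * T) := by
      ext y
      simp only [mem_vadd_set_iff_neg_vadd_mem, vadd_eq_add, Set.mem_neg, mem_Icc]
      constructor <;> rintro ⟨h1, h2⟩ <;> constructor <;> linarith
    rw [hs]
    ring

/-! ### Smoothness across the reflection point -/

section Regularity

variable {m : ℕ} {ε T : ℝ} {u : ℝ → ℝ}

/-- For `ε = ±1`, `hc` is void when `ε * (-1) ^ k = 1` and says that the derivative vanishes at `T`
when it is `-1`. -/
lemma iteratedDerivWithin_reflExt (hT : 0 < T) (hu : ContDiffOn ℝ m u (Icc 0 T))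
    (hc : ∀ k ≤ m, iteratedDerivWithin k u (Icc 0 T) T =
      ε * (-1) ^ k * iteratedDerivWithin k u (Icc 0 T) T) :
    ∀ k ≤ m, EqOn (iteratedDerivWithin k (reflExt ε T u) (Icc 0 (2 * T)))
      (reflExt (ε * (-1) ^ k) T (iteratedDerivWithin k u (Icc 0 T))) (Icc 0 (2 * T)) := by
  intro k
  induction k with
  | zero => intro _ x _; simp
  | succ k ih =>
    intro hk x hx
    have e : ε * (-1) ^ (k + 1) = -(ε * (-1) ^ k) := by ring
    rw [iteratedDerivWithin_succ, derivWithin_congr (ih (by lia)) (ih (by lia) hx), e]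
    refine (hasDerivWithinAt_reflExt hT (fun y hy => ?_) (hc k (by lia)) ?_ hx).derivWithin
      (uniqueDiffOn_Icc (by linarith) x hx)
    · rw [iteratedDerivWithin_succ]
      exact (hu.differentiableOn_iteratedDerivWithin (by exact_mod_cast hk)
        (uniqueDiffOn_Icc hT) y hy).hasDerivWithinAt
    · rw [← e]; exact hc _ hk

lemma contDiffOn_reflExt (hT : 0 < T) (hu : ContDiffOn ℝ m u (Icc 0 T))
    (hc : ∀ k ≤ m, iteratedDerivWithin k u (Icc 0 T) T =
      ε * (-1) ^ k * iteratedDerivWithin k u (Icc 0 T) T) :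
    ContDiffOn ℝ m (reflExt ε T u) (Icc 0 (2 * T)) := by
  have hE := iteratedDerivWithin_reflExt hT hu hc
  have hD : ∀ k < m, DifferentiableOn ℝ
      (iteratedDerivWithin k (reflExt ε T u) (Icc 0 (2 * T))) (Icc 0 (2 * T)) := by
    intro k hk
    refine DifferentiableOn.congr (fun x hx => ?_) (hE k hk.le)
    refine (hasDerivWithinAt_reflExt (f' := iteratedDerivWithin (k + 1) u (Icc 0 T)) hT
      (fun y hy => ?_) (hc k hk.le) ?_ hx).differentiableWithinAt
    · rw [iteratedDerivWithin_succ]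
      exact (hu.differentiableOn_iteratedDerivWithin (by exact_mod_cast hk)
        (uniqueDiffOn_Icc hT) y hy).hasDerivWithinAt
    · have e : -(ε * (-1) ^ k) = ε * (-1) ^ (k + 1) := by ring
      rw [e]; exact hc _ hk
  refine contDiffOn_of_continuousOn_differentiableOn_deriv (n := (m : ℕ∞)) (fun k hk => ?_)
    (fun k hk => hD k (by exact_mod_cast hk))
  have hk : k ≤ m := by exact_mod_cast hk
  refine ContinuousOn.congr ?_ (hE k hk)
  have hcont : ContinuousOn (iteratedDerivWithin k u (Icc 0 T)) (Icc 0 T) :=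
    hu.continuousOn_iteratedDerivWithin (by exact_mod_cast hk) (uniqueDiffOn_Icc hT)
  rw [← Icc_union_Icc_eq_Icc hT.le (by linarith : T ≤ 2 * T)]
  refine ContinuousOn.union_of_isClosed ?_ ?_ isClosed_Icc isClosed_Icc
  · exact hcont.congr fun x hx => reflExt_of_le _ hx.2
  · refine ContinuousOn.congr ?_ fun x hx => reflExt_of_ge (hc k hk) hx.1
    refine continuousOn_const.mul (hcont.comp (by fun_prop) fun y hy => ?_)
    exact ⟨by linarith [hy.2], by linarith [hy.1]⟩

end Regularity

/-! ### Absolute continuity and null sets under reflection -/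

lemma _root_.AbsolutelyContinuousOnInterval.congr {f g : ℝ → ℝ} {a b : ℝ}
    (hf : AbsolutelyContinuousOnInterval f a b) (h : EqOn f g (uIcc a b)) :
    AbsolutelyContinuousOnInterval g a b := by
  rw [absolutelyContinuousOnInterval_iff] at hf ⊢
  intro ε hε
  obtain ⟨δ, hδ, H⟩ := hf ε hε
  refine ⟨δ, hδ, fun E hE hl => ?_⟩
  convert H E hE hl using 1
  refine Finset.sum_congr rfl fun i hi => ?_
  rw [h (hE.1 i hi).1, h (hE.1 i hi).2]

lemma intervalIntegrable_reflExt {ε T : ℝ} {f : ℝ → ℝ} (hT : 0 < T)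
    (hf : IntervalIntegrable f volume 0 T) :
    IntervalIntegrable (reflExt ε T f) volume 0 (2 * T) := by
  have h2 : IntervalIntegrable (fun x => ε * f (2 * T - x)) volume T (2 * T) := by
    have := ((hf.comp_sub_left (2 * T)).const_mul ε).symm
    convert this using 1 <;> ring
  refine IntervalIntegrable.trans (b := T) (hf.congr fun x hx => ?_) (h2.congr fun x hx => ?_)
  · rw [uIoc_of_le hT.le] at hx
    exact (reflExt_of_le f hx.2).symm
  · rw [uIoc_of_le (by linarith)] at hx
    exact (reflExt_of_lt f hx.1).symm

/-- The extension is `g T` plus the primitive, based at `T`, of the reflected derivative with parity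
`-ε`, which is integrable. -/
lemma absolutelyContinuousOnInterval_reflExt {ε T : ℝ} {g : ℝ → ℝ} (hT : 0 < T)
    (hg : AbsolutelyContinuousOnInterval g 0 T) (hgT : g T = ε * g T) :
    AbsolutelyContinuousOnInterval (reflExt ε T g) 0 (2 * T) := by
  have hp := hg.intervalIntegrable_deriv
  have hq := intervalIntegrable_reflExt (ε := -ε) hT hp
  have hc : AbsolutelyContinuousOnInterval (fun _ : ℝ => g T) 0 (2 * T) :=
    ((LipschitzWith.const (g T)).lipschitzOnWith (s := uIcc 0 (2 * T))
      ).absolutelyContinuousOnInterval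
  have hmem : T ∈ uIcc 0 (2 * T) := by
    rw [uIcc_of_le (by linarith)]; exact ⟨hT.le, by linarith⟩
  refine (hc.add (hq.absolutelyContinuousOnInterval_intervalIntegral hmem)).congr fun x hx => ?_
  rw [uIcc_of_le (by linarith)] at hx
  rw [Pi.add_apply]
  have hsub : ∀ y ∈ Icc 0 T, ∫ s in y..T, deriv g s = g T - g y := fun y hy =>
    (hg.mono (by
      rw [uIcc_of_le hy.2, uIcc_of_le hT.le]
      exact Icc_subset_Icc_left hy.1)).integral_deriv_eq_sub
  rcases le_total x T with h | h
  · rw [reflExt_of_le g h]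
    have : ∫ s in T..x, reflExt (-ε) T (deriv g) s = ∫ s in T..x, deriv g s := by
      refine intervalIntegral.integral_congr fun s hs => reflExt_of_le _ ?_
      rw [uIcc_of_ge h] at hs
      exact hs.2
    rw [this, intervalIntegral.integral_symm, hsub x ⟨hx.1, h⟩]
    ring
  · rw [reflExt_of_ge hgT h]
    have : ∫ s in T..x, reflExt (-ε) T (deriv g) s =
        ∫ s in T..x, -ε * deriv g (2 * T - s) := by
      refine intervalIntegral.integral_congr_ae (Eventually.of_forall fun s hs => ?_)
      rw [uIoc_of_le h] at hs
      exact reflExt_of_lt _ hs.1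
    rw [this, intervalIntegral.integral_const_mul,
      intervalIntegral.integral_comp_sub_left (fun s => deriv g s),
      (by ring : 2 * T - T = T), hsub _ ⟨by linarith [hx.2], by linarith⟩]
    linarith

lemma ae_reflect {T : ℝ} {p : ℝ → Prop} (h : ∀ᵐ t ∂(volume.restrict (Icc 0 T)), p t) :
    ∀ᵐ t ∂(volume.restrict (Icc 0 (2 * T))), t ≠ T ∧ (t ≤ T → p t) ∧ (T < t → p (2 * T - t)) := by
  rw [ae_restrict_iff' measurableSet_Icc] at h ⊢
  have h' := (Measure.measurePreserving_sub_left volume (2 * T)).quasiMeasurePreserving.ae h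
  have hne : ∀ᵐ t : ℝ, t ≠ T := Measure.ae_ne volume T
  filter_upwards [h, h', hne] with t h1 h2 h3 ht
  exact ⟨h3, fun hle => h1 ⟨ht.1, hle⟩, fun hlt => h2 ⟨by linarith [ht.2], by linarith⟩⟩

/-! ### The extended boundary value problem -/

section Extension

variable {n : ℕ} {ε T : ℝ} {u : ℝ → ℝ}

/-- If the derivatives of `u` at `T` have the symmetry of the extension, the extension is as
regular as `u`, and it satisfies Neumann conditions on `[0,2T]`. -/
lemma reflExt_mem_neumannSpace (hn : 1 ≤ n) (hT : 0 < T) (hu : u ∈ sobolevSpace (2 * n) T)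
    (hu0 : ∀ k < n, iteratedDerivWithin (2 * k + 1) u (Icc 0 T) 0 = 0)
    (hc : ∀ k ≤ 2 * n - 1, iteratedDerivWithin k u (Icc 0 T) T =
      ε * (-1) ^ k * iteratedDerivWithin k u (Icc 0 T) T) :
    reflExt ε T u ∈ neumannSpace n (2 * T) := by
  have hE := iteratedDerivWithin_reflExt hT hu.1 hc
  refine ⟨⟨contDiffOn_reflExt hT hu.1 hc, ?_⟩, fun k hk => ⟨?_, ?_⟩⟩
  · refine (absolutelyContinuousOnInterval_reflExt hT hu.2 (hc _ le_rfl)).congr ?_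
    rw [uIcc_of_le (by linarith)]
    exact (hE _ le_rfl).symm
  · rw [hE _ (by lia) ⟨le_rfl, by linarith⟩, reflExt_of_le _ hT.le, hu0 k hk]
  · rw [hE _ (by lia) ⟨by linarith, le_rfl⟩, reflExt_of_lt _ (by linarith), sub_self, hu0 k hk,
      mul_zero]

/-- The sign `(-1) ^ k` of the coefficient cancels that of the `k`-th derivative, leaving `ε` in
every term. The point `T` is excluded because the derivatives of order `2 * n` need not match there.
-/
lemma linOp_reflExt (hn : 1 ≤ n) (hT : 0 < T) (a : ℕ → ℝ → ℝ)
    (hu : u ∈ sobolevSpace (2 * n) T)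
    (hc : ∀ k ≤ 2 * n - 1, iteratedDerivWithin k u (Icc 0 T) T =
      ε * (-1) ^ k * iteratedDerivWithin k u (Icc 0 T) T)
    {t : ℝ} (ht : t ∈ Icc 0 (2 * T)) (htT : t ≠ T) :
    linOp n (extCoeff T a) (2 * T) (reflExt ε T u) t = reflExt ε T (linOp n a T u) t := by
  have hE := iteratedDerivWithin_reflExt hT hu.1 hc
  have htop : iteratedDerivWithin (2 * n) (reflExt ε T u) (Icc 0 (2 * T)) t =
      reflExt ε T (iteratedDerivWithin (2 * n) u (Icc 0 T)) t := by
    obtain ⟨j, hj⟩ : ∃ j, 2 * n = j + 1 := ⟨2 * n - 1, by lia⟩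
    have hj' : j ≤ 2 * n - 1 := by lia
    rw [hj, iteratedDerivWithin_succ, derivWithin_congr (hE j hj') (hE j hj' ht),
      derivWithin_reflExt_of_ne _ htT, ← iteratedDerivWithin_succ]
    congr 1
    -- The leading term keeps the sign `ε` because the order `2 * n` is even.
    have : (-1 : ℝ) ^ (j + 1) = 1 := by rw [← hj, pow_mul]; simp
    rw [pow_succ] at this
    linear_combination ε * this
  have hlow : ∀ k ∈ Finset.range (2 * n),
      extCoeff T a k t * iteratedDerivWithin k (reflExt ε T u) (Icc 0 (2 * T)) t =
      reflExt ((-1) ^ k) T (a k) t *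
        reflExt (ε * (-1) ^ k) T (iteratedDerivWithin k u (Icc 0 T)) t := fun k hk => by
    rw [hE k (by have := Finset.mem_range.1 hk; lia) ht, extCoeff_eq_reflExt]
  unfold linOp
  rw [htop, Finset.sum_congr rfl hlow]
  rcases htT.lt_or_gt with h | h
  · simp only [reflExt_of_le _ h.le]
  · simp only [reflExt_of_lt _ h, mul_add, Finset.mul_sum]
    congr 1
    refine Finset.sum_congr rfl fun k _ => ?_
    have : ((-1 : ℝ) ^ k) * (-1) ^ k = 1 := by rw [← mul_pow]; simp
    linear_combination ε * a k (2 * T - t) *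
      iteratedDerivWithin k u (Icc 0 T) (2 * T - t) * this

lemma isSolution_reflExt (hn : 1 ≤ n) (hT : 0 < T) {a : ℕ → ℝ → ℝ} {σ : ℝ → ℝ}
    (hu : u ∈ sobolevSpace (2 * n) T)
    (hu0 : ∀ k < n, iteratedDerivWithin (2 * k + 1) u (Icc 0 T) 0 = 0)
    (hc : ∀ k ≤ 2 * n - 1, iteratedDerivWithin k u (Icc 0 T) T =
      ε * (-1) ^ k * iteratedDerivWithin k u (Icc 0 T) T)
    (hσ : ∀ᵐ t ∂(volume.restrict (Icc 0 T)), linOp n a T u t = σ t) :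
    IsSolution n (extCoeff T a) (2 * T) (neumannSpace n (2 * T)) (reflExt ε T σ)
      (reflExt ε T u) := by
  refine ⟨reflExt_mem_neumannSpace hn hT hu hu0 hc, ?_⟩
  filter_upwards [ae_reflect hσ, ae_restrict_mem measurableSet_Icc] with t h ht
  rw [linOp_reflExt hn hT a hu hc ht h.1]
  rcases h.1.lt_or_gt with h' | h'
  · rw [reflExt_of_le _ h'.le, reflExt_of_le _ h'.le, h.2.1 h'.le]
  · rw [reflExt_of_lt _ h', reflExt_of_lt _ h', h.2.2 h']

end Extension

/-- The even extension of a solution of the Neumann problem. -/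
lemma IsSolution.reflExt_one {n : ℕ} (hn : 1 ≤ n) {T : ℝ} (hT : 0 < T) {a : ℕ → ℝ → ℝ}
    {σ u : ℝ → ℝ} (hu : IsSolution n a T (neumannSpace n T) σ u) :
    IsSolution n (extCoeff T a) (2 * T) (neumannSpace n (2 * T)) (reflExt 1 T σ)
      (reflExt 1 T u) := by
  refine isSolution_reflExt hn hT hu.1.1 (fun k hk => (hu.1.2 k hk).1) (fun k hk => ?_) hu.2
  rcases k.even_or_odd' with ⟨j, rfl | rfl⟩
  · rw [pow_mul]; simp
  · rw [(hu.1.2 j (by lia)).2, mul_zero]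

/-- The odd extension of a solution of the first mixed problem. -/
lemma IsSolution.reflExt_neg_one {n : ℕ} (hn : 1 ≤ n) {T : ℝ} (hT : 0 < T) {a : ℕ → ℝ → ℝ}
    {σ u : ℝ → ℝ} (hu : IsSolution n a T (mixedOneSpace n T) σ u) :
    IsSolution n (extCoeff T a) (2 * T) (neumannSpace n (2 * T)) (reflExt (-1) T σ)
      (reflExt (-1) T u) := by
  refine isSolution_reflExt hn hT hu.1.1 (fun k hk => (hu.1.2 k hk).1) (fun k hk => ?_) hu.2
  rcases k.even_or_odd' with ⟨j, rfl | rfl⟩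
  · rw [(hu.1.2 j (by lia)).2, mul_zero]
  · rw [pow_succ, pow_mul]; simp

/-! ### Linearity and representation by the Green's function -/

section Uniqueness

variable {n : ℕ} {S : ℝ} {u v : ℝ → ℝ}

lemma iteratedDerivWithin_sub_of_mem_sobolevSpace (hS : 0 < S) {m k : ℕ} (hk : k ≤ m - 1)
    (hu : u ∈ sobolevSpace m S) (hv : v ∈ sobolevSpace m S) :
    EqOn (iteratedDerivWithin k (u - v) (Icc 0 S))
      (iteratedDerivWithin k u (Icc 0 S) - iteratedDerivWithin k v (Icc 0 S)) (Icc 0 S) := by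
  intro t ht
  have hk' : (k : WithTop ℕ∞) ≤ ((m - 1 : ℕ) : WithTop ℕ∞) := by exact_mod_cast hk
  exact iteratedDerivWithin_sub ht (uniqueDiffOn_Icc hS) ((hu.1 t ht).of_le hk')
    ((hv.1 t ht).of_le hk')

lemma sub_mem_sobolevSpace (hS : 0 < S) {m : ℕ} (hu : u ∈ sobolevSpace m S)
    (hv : v ∈ sobolevSpace m S) : u - v ∈ sobolevSpace m S := by
  refine ⟨hu.1.sub hv.1, (hu.2.sub hv.2).congr ?_⟩
  rw [uIcc_of_le hS.le]
  exact (iteratedDerivWithin_sub_of_mem_sobolevSpace hS le_rfl hu hv).symm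

lemma sub_mem_neumannSpace (hS : 0 < S) (hu : u ∈ neumannSpace n S)
    (hv : v ∈ neumannSpace n S) : u - v ∈ neumannSpace n S := by
  refine ⟨sub_mem_sobolevSpace hS hu.1 hv.1, fun k hk => ⟨?_, ?_⟩⟩
  · rw [iteratedDerivWithin_sub_of_mem_sobolevSpace hS (by lia) hu.1 hv.1 ⟨le_rfl, hS.le⟩,
      Pi.sub_apply, (hu.2 k hk).1, (hv.2 k hk).1, sub_self]
  · rw [iteratedDerivWithin_sub_of_mem_sobolevSpace hS (by lia) hu.1 hv.1 ⟨hS.le, le_rfl⟩,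
      Pi.sub_apply, (hu.2 k hk).2, (hv.2 k hk).2, sub_self]

/-- Linearity is claimed only almost everywhere: absolute continuity gives the top derivative only
there. -/
lemma ae_linOp_sub (hn : 1 ≤ n) (hS : 0 < S) (a : ℕ → ℝ → ℝ) (hu : u ∈ sobolevSpace (2 * n) S)
    (hv : v ∈ sobolevSpace (2 * n) S) :
    ∀ᵐ t ∂(volume.restrict (Icc 0 S)),
      linOp n a S (u - v) t = linOp n a S u t - linOp n a S v t := by
  have hdu := hu.2.ae_differentiableAt
  have hdv := hv.2.ae_differentiableAt
  rw [uIcc_of_le hS.le] at hdu hdv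
  rw [ae_restrict_iff' measurableSet_Icc]
  filter_upwards [hdu, hdv] with t h1 h2 ht
  have hE : ∀ k ≤ 2 * n - 1, _ := fun k hk =>
    iteratedDerivWithin_sub_of_mem_sobolevSpace hS hk hu hv
  have htop : iteratedDerivWithin (2 * n) (u - v) (Icc 0 S) t =
      iteratedDerivWithin (2 * n) u (Icc 0 S) t - iteratedDerivWithin (2 * n) v (Icc 0 S) t := by
    have hj : 2 * n = (2 * n - 1) + 1 := by lia
    rw [hj, iteratedDerivWithin_succ, derivWithin_congr (hE _ le_rfl) (hE _ le_rfl ht),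
      iteratedDerivWithin_succ, iteratedDerivWithin_succ]
    exact derivWithin_sub (h1 ht).differentiableWithinAt (h2 ht).differentiableWithinAt
  unfold linOp
  rw [htop, Finset.sum_congr rfl fun k hk => by
    rw [hE k (by have := Finset.mem_range.1 hk; lia) ht, Pi.sub_apply, mul_sub],
    Finset.sum_sub_distrib]
  ring

/-- In the nonresonant case every solution is given by the Green's function. -/
lemma IsSolution.eq_integral {a : ℕ → ℝ → ℝ} {G : ℝ → ℝ → ℝ} {σ : ℝ → ℝ} (hn : 1 ≤ n)
    (hS : 0 < S) (hL : Nonresonant n a S (neumannSpace n S))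
    (hG : IsGreenFunction n a S (neumannSpace n S) G) (hσ : IntegrableOn σ (Icc 0 S))
    (hu : IsSolution n a S (neumannSpace n S) σ u) {t : ℝ} (ht : t ∈ Icc 0 S) :
    u t = ∫ s in (0 : ℝ)..S, G t s * σ s := by
  have hv := hG.2 σ hσ
  refine sub_eq_zero.1 (hL _ ⟨sub_mem_neumannSpace hS hu.1 hv.1, ?_⟩ t ht)
  filter_upwards [ae_linOp_sub hn hS a hu.1.1 hv.1.1, hu.2, hv.2] with x h h1 h2
  rw [h, h1, h2, sub_self, Pi.zero_apply]

end Uniqueness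

lemma intervalIntegrable_kernel_mul {S t : ℝ} {G : ℝ → ℝ → ℝ} {σ : ℝ → ℝ} (hS : 0 ≤ S)
    (hG : ContinuousOn (fun p : ℝ × ℝ => G p.1 p.2) (Icc 0 S ×ˢ Icc 0 S)) (ht : t ∈ Icc 0 S)
    (hσ : IntegrableOn σ (Icc 0 S)) :
    IntervalIntegrable (fun s => G t s * σ s) volume 0 S := by
  have hσ' : IntervalIntegrable σ volume 0 S :=
    (intervalIntegrable_iff_integrableOn_Icc_of_le hS).2 hσ
  refine hσ'.continuousOn_mul ?_
  rw [uIcc_of_le hS]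
  exact hG.comp (f := fun s => (t, s)) (by fun_prop) fun s hs => ⟨ht, hs⟩

lemma integrableOn_reflExt {ε T : ℝ} {f : ℝ → ℝ} (hT : 0 < T) (hf : IntegrableOn f (Icc 0 T)) :
    IntegrableOn (reflExt ε T f) (Icc 0 (2 * T)) :=
  (intervalIntegrable_iff_integrableOn_Icc_of_le (by linarith)).1
    (intervalIntegrable_reflExt hT ((intervalIntegrable_iff_integrableOn_Icc_of_le hT.le).2 hf))

end EvenOrderBVP

/-! ### Comparison of the two solutions -/

theorem mainTheorem9 (n : ℕ) (hn : 1 ≤ n) (T : ℝ) (hT : 0 < T)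
    (a : ℕ → ℝ → ℝ) (ha : ∀ k < 2 * n, IntegrableOn (a k) (Icc 0 T))
    (hL : EvenOrderBVP.Nonresonant n (EvenOrderBVP.extCoeff T a) (2 * T)
      (EvenOrderBVP.neumannSpace n (2 * T)))
    (G : ℝ → ℝ → ℝ)
    (hG : EvenOrderBVP.IsGreenFunction n (EvenOrderBVP.extCoeff T a) (2 * T)
      (EvenOrderBVP.neumannSpace n (2 * T)) G)
    (σ₁ σ₂ : ℝ → ℝ) (hσ₁ : IntegrableOn σ₁ (Icc 0 T)) (hσ₂ : IntegrableOn σ₂ (Icc 0 T))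
    (uN uM : ℝ → ℝ)
    (huN : EvenOrderBVP.IsSolution n a T (EvenOrderBVP.neumannSpace n T) σ₁ uN)
    (huM : EvenOrderBVP.IsSolution n a T (EvenOrderBVP.mixedOneSpace n T) σ₂ uM) :
    ((∀ t ∈ Icc 0 (2 * T), ∀ s ∈ Icc 0 (2 * T), 0 ≤ G t s) →
      (∀ᵐ t ∂(volume.restrict (Icc 0 T)), |σ₂ t| ≤ σ₁ t) →
      ∀ t ∈ Icc 0 T, |uM t| ≤ uN t) ∧
    ((∀ t ∈ Icc 0 (2 * T), ∀ s ∈ Icc 0 (2 * T), G t s ≤ 0) →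
      (∀ᵐ t ∂(volume.restrict (Icc 0 T)), 0 ≤ σ₂ t ∧ σ₂ t ≤ σ₁ t) →
      ∀ t ∈ Icc 0 T, uN t ≤ 0 ∧ uN t ≤ uM t) ∧
    ((∀ t ∈ Icc 0 (2 * T), ∀ s ∈ Icc 0 (2 * T), G t s ≤ 0) →
      (∀ᵐ t ∂(volume.restrict (Icc 0 T)), σ₁ t ≤ σ₂ t ∧ σ₂ t ≤ 0) →
      ∀ t ∈ Icc 0 T, 0 ≤ uN t ∧ uM t ≤ uN t) := by
  have hS : 0 < 2 * T := by linarith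
  have hσ₁' := EvenOrderBVP.integrableOn_reflExt (ε := 1) hT hσ₁
  have hσ₂' := EvenOrderBVP.integrableOn_reflExt (ε := -1) hT hσ₂
  have hmem : ∀ t ∈ Icc 0 T, t ∈ Icc 0 (2 * T) := fun t ht => ⟨ht.1, by linarith [ht.2]⟩
  have hN : ∀ t ∈ Icc 0 T,
      uN t = ∫ s in (0 : ℝ)..2 * T, G t s * EvenOrderBVP.reflExt 1 T σ₁ s := fun t ht => by
    rw [← (huN.reflExt_one hn hT).eq_integral hn hS hL hG hσ₁' (hmem t ht),
      EvenOrderBVP.reflExt_of_le _ ht.2]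
  have hM : ∀ t ∈ Icc 0 T,
      uM t = ∫ s in (0 : ℝ)..2 * T, G t s * EvenOrderBVP.reflExt (-1) T σ₂ s := fun t ht => by
    rw [← (huM.reflExt_neg_one hn hT).eq_integral hn hS hL hG hσ₂' (hmem t ht),
      EvenOrderBVP.reflExt_of_le _ ht.2]
  have hi₁ := fun t ht =>
    EvenOrderBVP.intervalIntegrable_kernel_mul hS.le hG.1 (hmem t ht) hσ₁'
  have hi₂ := fun t ht =>
    EvenOrderBVP.intervalIntegrable_kernel_mul hS.le hG.1 (hmem t ht) hσ₂'
  have mono : ∀ {f g : ℝ → ℝ}, IntervalIntegrable f volume 0 (2 * T) →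
      IntervalIntegrable g volume 0 (2 * T) →
      (∀ᵐ s ∂(volume.restrict (Icc 0 (2 * T))), f s ≤ g s) →
      ∫ s in (0 : ℝ)..2 * T, f s ≤ ∫ s in (0 : ℝ)..2 * T, g s := fun hf hg h =>
    intervalIntegral.integral_mono_ae_restrict hS.le hf hg h
  refine ⟨fun hpos h t ht => ?_, fun hneg h t ht => ?_, fun hneg h t ht => ?_⟩
  · have hb : ∀ᵐ s ∂(volume.restrict (Icc 0 (2 * T))),
        |EvenOrderBVP.reflExt (-1) T σ₂ s| ≤ EvenOrderBVP.reflExt 1 T σ₁ s := by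
      filter_upwards [EvenOrderBVP.ae_reflect h] with s hs
      rcases le_or_gt s T with h' | h'
      · simpa only [EvenOrderBVP.reflExt_of_le _ h'] using hs.2.1 h'
      · simpa [EvenOrderBVP.reflExt_of_lt _ h'] using hs.2.2 h'
    rw [abs_le, hN t ht, hM t ht, ← intervalIntegral.integral_neg]
    refine ⟨mono (hi₁ t ht).neg (hi₂ t ht) ?_, mono (hi₂ t ht) (hi₁ t ht) ?_⟩
    · filter_upwards [hb, ae_restrict_mem measurableSet_Icc] with s hs hs'
      have := mul_le_mul_of_nonneg_left (abs_le.1 hs).1 (hpos t (hmem t ht) s hs')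
      linarith
    · filter_upwards [hb, ae_restrict_mem measurableSet_Icc] with s hs hs'
      exact mul_le_mul_of_nonneg_left (abs_le.1 hs).2 (hpos t (hmem t ht) s hs')
  -- On the reflected half the bound reads `-σ₂ ≤ σ₁`, which holds since `-σ₂ ≤ 0 ≤ σ₁`.
  · have hb : ∀ᵐ s ∂(volume.restrict (Icc 0 (2 * T))), 0 ≤ EvenOrderBVP.reflExt 1 T σ₁ s ∧
        EvenOrderBVP.reflExt (-1) T σ₂ s ≤ EvenOrderBVP.reflExt 1 T σ₁ s := by
      filter_upwards [EvenOrderBVP.ae_reflect h] with s hs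
      rcases le_or_gt s T with h' | h'
      · have := hs.2.1 h'
        simp only [EvenOrderBVP.reflExt_of_le _ h']
        constructor <;> linarith
      · have := hs.2.2 h'
        simp only [EvenOrderBVP.reflExt_of_lt _ h']
        constructor <;> linarith
    rw [hN t ht, hM t ht]
    refine ⟨?_, mono (hi₁ t ht) (hi₂ t ht) ?_⟩
    · refine (mono (hi₁ t ht) (intervalIntegrable_const (c := 0)) ?_).trans_eq
        intervalIntegral.integral_zero
      filter_upwards [hb, ae_restrict_mem measurableSet_Icc] with s hs hs'
      exact mul_nonpos_of_nonpos_of_nonneg (hneg t (hmem t ht) s hs') hs.1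
    · filter_upwards [hb, ae_restrict_mem measurableSet_Icc] with s hs hs'
      exact mul_le_mul_of_nonpos_left hs.2 (hneg t (hmem t ht) s hs')
  -- Here the reflected half needs `σ₁ ≤ -σ₂`, which follows from `σ₁ ≤ 0 ≤ -σ₂`.
  · have hb : ∀ᵐ s ∂(volume.restrict (Icc 0 (2 * T))), EvenOrderBVP.reflExt 1 T σ₁ s ≤ 0 ∧
        EvenOrderBVP.reflExt 1 T σ₁ s ≤ EvenOrderBVP.reflExt (-1) T σ₂ s := by
      filter_upwards [EvenOrderBVP.ae_reflect h] with s hs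
      rcases le_or_gt s T with h' | h'
      · have := hs.2.1 h'
        simp only [EvenOrderBVP.reflExt_of_le _ h']
        constructor <;> linarith
      · have := hs.2.2 h'
        simp only [EvenOrderBVP.reflExt_of_lt _ h']
        constructor <;> linarith
    rw [hN t ht, hM t ht]
    refine ⟨?_, mono (hi₂ t ht) (hi₁ t ht) ?_⟩
    · refine intervalIntegral.integral_zero.symm.trans_le
        (mono (intervalIntegrable_const (c := 0)) (hi₁ t ht) ?_)
      filter_upwards [hb, ae_restrict_mem measurableSet_Icc] with s hs hs'
      exact mul_nonneg_of_nonpos_of_nonpos (hneg t (hmem t ht) s hs') hs.1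
    · filter_upwards [hb, ae_restrict_mem measurableSet_Icc] with s hs hs'
      exact mul_le_mul_of_nonpos_left hs.2 (hneg t (hmem t ht) s hs')
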